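/- Consider interactive proof systems whose (private-coin) verifier is a sweeping probabilistic finite automaton (PFA). The verifier is a two-way PFA with arbitrary real transition probabilities and no work tape. It reads its input $w$ on the tape $¢ w \$$, has a head that changes direction only on the end-markers, and exchanges symbols of a finite communication alphabet with a prover; the prover sees only the input and the symbols sent by the verifier. Such a verifier verifies a language $L$ with error bound $\epsilon<\frac12$ if (1) some prover makes it accept every $w\in L$ with probability at least $1-\epsilon$, and (2) with every prover it rejects every $w\notin L$ with probability at least $1-\epsilon$. It runs in linear time if, with every prover, every computation path on an input of length $n$ halts within $O(n)$ steps (at most $c(n+1)$ steps, for a constant $c$ depending only on the verifier). Let $$\mathtt{DIMA2}=\{0^{2^0}10^{2^1}10^{2^2}1\cdots 10^{2^{3k-1}}11(0^{2^{3k}}1)^{2^{3k}} \mid k>0\},$$ let $w_k$ be the $k$-th shortest member of $\mathtt{DIMA2}$, and for $I\subseteq\mathbb{Z}^+$ let $\mathtt{DIMA2}(I)=\{w_k\mid k\in I\}$. Theorem. For every $I\subseteq\mathbb{Z}^+$, the language $\mathtt{DIMA2}(I)$ is verified with bounded error (some error bound $\epsilon<\frac12$) in linear time by a sweeping PFA verifier.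 Consequently, the set of binary languages that are verified with bounded error in linear time by sweeping PFA verifiers is uncountable. -/

import Mathlib

/-- The contents of a cell of the input tape: the left end-marker, the right end-marker, or an
input symbol. -/
inductive TapeSymbol (α : Type) : Type
  | leftEnd : TapeSymbol α
  | rightEnd : TapeSymbol α
  | sym (a : α) : TapeSymbol α

/-- The input `w` is written on the cells `1, …, |w|`, between the left end-marker on cell `0` and
the right end-marker on cell `|w| + 1`. -/
def tapeCell {α : Type} (w : List α) (p : ℕ) : TapeSymbol α :=
  if p = 0 then TapeSymbol.leftEnd
  else match w[p - 1]? with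
    | some a => TapeSymbol.sym a
    | none => TapeSymbol.rightEnd

/-- The moves of the input head. -/
inductive HeadMove : Type
  | left : HeadMove
  | stay : HeadMove
  | right : HeadMove

/-- The head position after a move from position `p`. -/
def HeadMove.apply (d : HeadMove) (p : ℕ) : ℕ :=
  match d with
  | HeadMove.left => p - 1
  | HeadMove.stay => p
  | HeadMove.right => p + 1

/-- The states of a verifier: reading states, communicating states, and the two halting states. -/
inductive VerifierState (R C : Type) : Type
  | read (r : R) : VerifierState R C
  | comm (c : C) : VerifierState R C
  | accept : VerifierState R C
  | reject : VerifierState R C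

/-- A two-way probabilistic finite automaton verifier (a verifier without work tape) with input
alphabet `α`. The transition probabilities are arbitrary real numbers. -/
structure PFAVerifier (α : Type) : Type 1 where
  /-- the reading states -/
  ReadState : Type
  /-- the communicating states -/
  CommState : Type
  /-- the communication alphabet -/
  Msg : Type
  finite_readState : Finite ReadState
  finite_commState : Finite CommState
  finite_msg : Finite Msg
  nonempty_msg : Nonempty Msg
  /-- the initial state, a reading state -/
  init : ReadState
  /-- in a reading state: the distribution of the next state and of the head move, given the
  symbol under the input head -/
  readStep : ReadState → TapeSymbol α → PMF (VerifierState ReadState CommState × HeadMove)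
  /-- in a communicating state: the symbol written on the communication cell -/
  send : CommState → Msg
  /-- in a communicating state: the next state, given the symbol written back by the prover -/
  receive : CommState → Msg → VerifierState ReadState CommState
  /-- the head never leaves the tape on the left -/
  not_left_of_leftEnd : ∀ (r : ReadState) (s : VerifierState ReadState CommState),
    (s, HeadMove.left) ∉ (readStep r TapeSymbol.leftEnd).support
  /-- the head never leaves the tape on the right -/
  not_right_of_rightEnd : ∀ (r : ReadState) (s : VerifierState ReadState CommState),
    (s, HeadMove.right) ∉ (readStep r TapeSymbol.rightEnd).support

namespace PFAVerifier

variable {α : Type}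

/-- The states of `V`. -/
abbrev State (V : PFAVerifier α) : Type := VerifierState V.ReadState V.CommState

/-- A prover for `V`: it answers on the basis of the input and of the symbols that `V` has written
on the communication cell so far (most recent first), and of nothing else. Its computational power
is unlimited. -/
abbrev Prover (V : PFAVerifier α) : Type := List α → List V.Msg → V.Msg

/-- A configuration on a given input: the state, the position of the input head, and the symbols
written so far on the communication cell by the verifier (most recent first). -/
structure Config (V : PFAVerifier α) : Type where
  state : V.State
  pos : ℕ
  sent : List V.Msg

/-- The initial configuration: the head is on the left end-marker, nothing has been sent. -/
def initConfig (V : PFAVerifier α) : V.Config := ⟨VerifierState.read V.init, 0, []⟩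

/-- The distribution of the configuration after one step, when `V` works on the input `w` and
communicates with the prover `P`. A halted computation stays as it is. -/
noncomputable def step (V : PFAVerifier α) (P : V.Prover) (w : List α) (c : V.Config) :
    PMF V.Config :=
  match c.state with
  | VerifierState.read r =>
      (V.readStep r (tapeCell w c.pos)).map fun x => ⟨x.1, x.2.apply c.pos, c.sent⟩
  | VerifierState.comm q =>
      PMF.pure ⟨V.receive q (P w (V.send q :: c.sent)), c.pos, V.send q :: c.sent⟩
  | VerifierState.accept => PMF.pure c
  | VerifierState.reject => PMF.pure c

/-- The distribution of the configuration after `t` steps. -/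
noncomputable def run (V : PFAVerifier α) (P : V.Prover) (w : List α) : ℕ → PMF V.Config
  | 0 => PMF.pure V.initConfig
  | t + 1 => (V.run P w t).bind (V.step P w)

/-- The probability of ever being in the state `s`, for a halting state `s`: the probability of
being in `s` after `t` steps is then nondecreasing in `t`. -/
noncomputable def haltProb (V : PFAVerifier α) (P : V.Prover) (w : List α) (s : V.State) :
    ENNReal :=
  ⨆ t : ℕ, ((V.run P w t).map Config.state) s

/-- The probability that `V` accepts `w` when it communicates with `P`. -/
noncomputable def acceptProb (V : PFAVerifier α) (P : V.Prover) (w : List α) : ENNReal :=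
  V.haltProb P w VerifierState.accept

/-- The probability that `V` rejects `w` when it communicates with `P`. -/
noncomputable def rejectProb (V : PFAVerifier α) (P : V.Prover) (w : List α) : ENNReal :=
  V.haltProb P w VerifierState.reject

/-- `V` verifies the language `L` with error bound `ε`: an honest prover makes `V` accept every
member with probability at least `1 - ε`, and, whatever the prover is, every non-member is rejected
with probability at least `1 - ε`. -/
def Verifies (V : PFAVerifier α) (L : Language α) (ε : ℝ) : Prop :=
  (∃ P : V.Prover, ∀ w : List α, w ∈ L → ENNReal.ofReal (1 - ε) ≤ V.acceptProb P w) ∧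
  (∀ P : V.Prover, ∀ w : List α, w ∉ L → ENNReal.ofReal (1 - ε) ≤ V.rejectProb P w)

/-- `ρ` is a possible computation path of `V` on `w` with the prover `P`: each of its steps has
positive probability. -/
def IsPath (V : PFAVerifier α) (P : V.Prover) (w : List α) (ρ : ℕ → V.Config) : Prop :=
  ρ 0 = V.initConfig ∧ ∀ t : ℕ, ρ (t + 1) ∈ (V.step P w (ρ t)).support

/-- `V` is sweeping: the input head changes its direction only on the end-markers. In detail: on
any input, with any prover, on any computation path, if step `i` moves the head in one direction
and the next step `j` that moves the head moves it in the other direction, then the head is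
on an end-marker when it turns. -/
def IsSweeping (V : PFAVerifier α) : Prop :=
  ∀ (P : V.Prover) (w : List α) (ρ : ℕ → V.Config), V.IsPath P w ρ →
    ∀ i j : ℕ, i < j → (∀ l : ℕ, i < l → l ≤ j → (ρ l).pos = (ρ j).pos) →
      (((ρ i).pos < (ρ j).pos ∧ (ρ (j + 1)).pos < (ρ j).pos) ∨
        ((ρ j).pos < (ρ i).pos ∧ (ρ j).pos < (ρ (j + 1)).pos)) →
      (ρ j).pos = 0 ∨ (ρ j).pos = w.length + 1

/-- `V` runs in linear time: there is a constant `c` such that on every input of length `n`, with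
every prover, every computation path halts within `c * (n + 1)` steps. -/
def IsLinearTime (V : PFAVerifier α) : Prop :=
  ∃ c : ℕ, ∀ (P : V.Prover) (w : List α) (ρ : ℕ → V.Config), V.IsPath P w ρ →
    (ρ (c * (w.length + 1))).state = VerifierState.accept ∨
      (ρ (c * (w.length + 1))).state = VerifierState.reject

end PFAVerifier

/-- `L` is verified in linear time with bounded error by some sweeping PFA verifier. -/
def LinearTimeSweepingVerifiable {α : Type} (L : Language α) : Prop :=
  ∃ V : PFAVerifier α, V.IsSweeping ∧ V.IsLinearTime ∧ ∃ ε : ℝ, ε < 1 / 2 ∧ V.Verifies L ε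

/-- The word `0^m 1`; the letters `0` and `1` are `false` and `true`. -/
def zerosOne (m : ℕ) : List Bool := List.replicate m false ++ [true]

/-- The word `0^(2^0) 1 0^(2^1) 1 ⋯ 1 0^(2^(3k-1)) 1 1 (0^(2^(3k)) 1)^(2^(3k))`. -/
def dima2Word (k : ℕ) : List Bool :=
  (List.range (3 * k)).flatMap (fun i => zerosOne (2 ^ i)) ++ [true] ++
    (List.replicate (2 ^ (3 * k)) (zerosOne (2 ^ (3 * k)))).flatten

/-- The language `DIMA2`. -/
def DIMA2 : Language Bool := {w | ∃ k : ℕ, 0 < k ∧ w = dima2Word k}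

/-- `w` is the `k`-th shortest member of the language `L`: it is a member of `L`, and
exactly `k` members of `L` are at most as long as `w`. -/
def IsKthShortest {α : Type} (L : Language α) (k : ℕ) (w : List α) : Prop :=
  w ∈ L ∧ {v : List α | v ∈ L ∧ v.length ≤ w.length}.encard = k

/-- The language `DIMA2(I)` of the words that are the `k`-th shortest member of `DIMA2` for some
`k` in the set `I` of positive integers. -/
def DIMA2Sub (I : Set ℕ+) : Language Bool :=
  {w | ∃ k : ℕ+, k ∈ I ∧ IsKthShortest DIMA2 k w}

theorem dima2Word_length_strictMono : StrictMono fun k : ℕ => (dima2Word k).length := by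
  refine strictMono_nat_of_lt_succ fun k => ?_
  have h1 : 2 ^ (3 * k) < 2 ^ (3 * (k + 1)) := Nat.pow_lt_pow_right (by norm_num) (by omega)
  have h2 : 3 * (k + 1) = 3 * k + 1 + 1 + 1 := by ring
  simp only [dima2Word, zerosOne, List.length_append, List.length_flatMap, List.length_flatten,
    List.map_replicate, List.sum_replicate, List.length_replicate, List.length_singleton,
    smul_eq_mul]
  have h3 : ((List.range (3 * k)).map fun i => 2 ^ i + 1).sum ≤
      ((List.range (3 * (k + 1))).map fun i => 2 ^ i + 1).sum := by
    rw [h2]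
    simp only [List.range_succ, List.map_append, List.sum_append]
    omega
  have h4 : 2 ^ (3 * k) * (2 ^ (3 * k) + 1) < 2 ^ (3 * (k + 1)) * (2 ^ (3 * (k + 1)) + 1) :=
    Nat.mul_lt_mul'' h1 (by omega)
  omega

/-- The `k`-th shortest member of `DIMA2` is the displayed word with parameter `k`. -/
theorem isKthShortest_DIMA2_iff (k : ℕ) (hk : 0 < k) (w : List Bool) :
    IsKthShortest DIMA2 k w ↔ w = dima2Word k := by
  have key : ∀ m : ℕ, {v : List Bool | v ∈ DIMA2 ∧ v.length ≤ (dima2Word m).length}.encard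
      = m := by
    intro m
    have hset : {v : List Bool | v ∈ DIMA2 ∧ v.length ≤ (dima2Word m).length} =
        dima2Word '' (Finset.Icc 1 m : Finset ℕ) := by
      ext v
      constructor
      · rintro ⟨⟨j, hj, rfl⟩, hle⟩
        exact ⟨j, by simpa using ⟨hj, dima2Word_length_strictMono.le_iff_le.1 hle⟩, rfl⟩
      · rintro ⟨j, hj, rfl⟩
        have hj' : 1 ≤ j ∧ j ≤ m := by simpa using hj
        exact ⟨⟨j, hj'.1, rfl⟩, dima2Word_length_strictMono.le_iff_le.2 hj'.2⟩
    have hinj : Function.Injective dima2Word := fun a b h =>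
      dima2Word_length_strictMono.injective (congrArg List.length h)
    rw [hset, hinj.encard_image, Set.encard_coe_eq_coe_finsetCard]
    simp
  constructor
  · rintro ⟨⟨m, hm, rfl⟩, h⟩
    rw [key] at h
    rw [Nat.cast_inj.1 h]
  · rintro rfl
    exact ⟨⟨k, hk, rfl⟩, key k⟩

/-! All requests to the prover look alike, so on a fixed input the prover commits to one message,
the same whichever test was drawn. Deterministic tests pin down the input together with the message.
`copy` makes the message begin with the input `w`; the other two then compare `w` with itself
through the message. `double` runs one block behind, forcing block lengths to double up to the first
block after the doubled `1` and to stay constant from there on. `count` forces the number of blocks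
after the doubled `1` to equal their length. A finite-state scan supplies the first block, the
parities and the number of blocks modulo 3. Hence all tests pass only if `w` is some `dima2Word k`
and the message begins with `w` (`mem_DIMA2_of_transcript_prefix`); conversely
`dima2Word_scan_transcript`.

Whether `k ∈ I` is encoded in the bias `p` of a coin, whose `k`-th octal digit is 5 or 1. Let `m =
8^k`. Over the `m(m+1)` symbols of the second part, each head fetches one more message symbol, so
`h` heads yield `⌊h/(m+1)⌋` ones. The mean of `h` is `(m+1)·mp` and its variance is at most
`(m+1)²/4`; by Chebyshev, `h` is within `m+1` of its mean with probability at least `3/4`. The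
number of ones modulo 8 is then within 1 of the digit, and the threshold 4 separates the two cases
(`le_hitFrom_coin`, `le_hitFrom_coin_dima2Word`).

Rejecting outright with probability `3/7` balances the errors: members are accepted, and non-members
rejected, with probability at least `(3 + 3/4)/7 = 15/28`. Different sets `I` give different
languages, so Cantor's theorem gives uncountability. -/

namespace PFAVerifier

/-! ### Hitting probabilities, and criteria for sweeping and for linear time -/

variable {α : Type} (V : PFAVerifier α) (P : V.Prover) (w : List α)

/-- The distribution of the configuration `t` steps after the configuration `c`. -/
noncomputable def runFrom : ℕ → V.Config → PMF V.Config
  | 0, c => PMF.pure c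
  | t + 1, c => (V.step P w c).bind (runFrom t)

theorem run_bind_runFrom (t m : ℕ) :
    (V.run P w t).bind (V.runFrom P w m) = V.runFrom P w (t + m) V.initConfig := by
  induction t generalizing m with
  | zero => simp [run]
  | succ t ih =>
    rw [run, PMF.bind_bind, Nat.succ_add_eq_add_succ, ← ih]
    rfl

theorem run_eq_runFrom (t : ℕ) : V.run P w t = V.runFrom P w t V.initConfig := by
  rw [← Nat.add_zero t, ← run_bind_runFrom]
  exact (PMF.bind_pure _).symm

/-- The probability of being in the state `s` after `t` steps from the configuration `c`. -/
noncomputable def hitWithin (s : V.State) (t : ℕ) (c : V.Config) : ENNReal :=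
  ((V.runFrom P w t c).map Config.state) s

/-- The probability of reaching the halting state `s` from the configuration `c`. -/
noncomputable def hitFrom (s : V.State) (c : V.Config) : ENNReal := ⨆ t, V.hitWithin P w s t c

variable {V P w} {s : V.State} {c : V.Config}

theorem haltProb_eq_hitFrom : V.haltProb P w s = V.hitFrom P w s V.initConfig := by
  simp only [haltProb, hitFrom, hitWithin, run_eq_runFrom]

theorem hitWithin_succ (t : ℕ) :
    V.hitWithin P w s (t + 1) c = ∑' c', V.step P w c c' * V.hitWithin P w s t c' := by
  rw [hitWithin, runFrom, PMF.map_bind, PMF.bind_apply]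
  rfl

theorem hitWithin_zero_of_state_eq (h : c.state = s) : V.hitWithin P w s 0 c = 1 := by
  simp [hitWithin, runFrom, PMF.pure_map, h]

theorem hitWithin_zero_of_state_ne (h : c.state ≠ s) : V.hitWithin P w s 0 c = 0 := by
  simp [hitWithin, runFrom, PMF.pure_map, Ne.symm h]

/-- Halted configurations are fixed by `step`. Monotonicity is what lets the supremum over time
commute with finite sums. -/
theorem monotone_hitWithin (hs : s = .accept ∨ s = .reject) (c : V.Config) :
    Monotone fun t => V.hitWithin P w s t c := by
  refine monotone_nat_of_le_succ fun t => ?_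
  induction t generalizing c with
  | zero =>
    by_cases h : c.state = s
    · have hstep : V.step P w c = PMF.pure c := by
        rcases hs with rfl | rfl <;> simp [step, h]
      rw [hitWithin, hitWithin, runFrom, runFrom, hstep, PMF.pure_bind, runFrom]
    · rw [hitWithin_zero_of_state_ne h]
      exact zero_le
  | succ t ih =>
    rw [hitWithin_succ, hitWithin_succ]
    exact ENNReal.tsum_le_tsum fun c' => mul_le_mul_right (ih c') _

theorem hitFrom_of_state_eq (h : c.state = s) : 1 ≤ V.hitFrom P w s c :=
  le_iSup_of_le 0 (hitWithin_zero_of_state_eq h).ge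

/-- First-step analysis. Every claim about the verifier is a lower bound, so this one inequality
suffices. -/
theorem sum_hitFrom_le {ι : Type} [Fintype ι] (hs : s = .accept ∨ s = .reject)
    {μ : PMF ι} {F : ι → V.Config} (h : V.step P w c = μ.map F) :
    ∑ i, μ i * V.hitFrom P w s (F i) ≤ V.hitFrom P w s c := by
  have hsucc : ∀ t, ∑ i, μ i * V.hitWithin P w s t (F i) = V.hitWithin P w s (t + 1) c := by
    intro t
    rw [hitWithin, runFrom, h, PMF.bind_map, PMF.map_bind, PMF.bind_apply, tsum_fintype]
    rfl
  simp only [hitFrom, ENNReal.mul_iSup]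
  rw [ENNReal.finsetSum_iSup_of_monotone (f := fun i t => μ i * V.hitWithin P w s t (F i))
    fun i _ _ hle => mul_le_mul_right (monotone_hitWithin hs (F i) hle) _]
  exact iSup_le fun t => (hsucc t).le.trans (le_iSup (fun t => V.hitWithin P w s t c) _)

theorem hitFrom_le_of_step_eq_pure (hs : s = .accept ∨ s = .reject) {c' : V.Config}
    (h : V.step P w c = PMF.pure c') : V.hitFrom P w s c' ≤ V.hitFrom P w s c := by
  have := sum_hitFrom_le (ι := Unit) hs (μ := PMF.pure ()) (F := fun _ => c')
    (by rw [h, PMF.pure_map])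
  simpa using this

/-- The step of a verifier in a reading state whose transition is drawn from `μ`. -/
theorem step_read {ι : Type} {r : V.ReadState} {p : ℕ} {l : List V.Msg} {μ : PMF ι}
    {G : ι → V.State × HeadMove} (h : V.readStep r (tapeCell w p) = μ.map G) :
    V.step P w ⟨.read r, p, l⟩ = μ.map fun i => ⟨(G i).1, (G i).2.apply p, l⟩ := by
  simp only [step, h, PMF.map_comp]
  rfl

theorem step_read_pure {r : V.ReadState} {p : ℕ} {l : List V.Msg} {x : V.State × HeadMove}
    (h : V.readStep r (tapeCell w p) = PMF.pure x) :
    V.step P w ⟨.read r, p, l⟩ = PMF.pure ⟨x.1, x.2.apply p, l⟩ := by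
  simp only [step, h, PMF.pure_map]

theorem isSweeping_of_pos_le
    (h : ∀ (P : V.Prover) (w : List α) (c c' : V.Config), c' ∈ (V.step P w c).support →
      c.pos ≤ c'.pos) : V.IsSweeping := by
  intro P w ρ hρ i j hij _ hturn
  have hmono : Monotone fun t => (ρ t).pos := monotone_nat_of_le_succ fun t => h P w _ _ (hρ.2 t)
  have h1 : (ρ i).pos ≤ (ρ j).pos := hmono hij.le
  have h2 : (ρ j).pos ≤ (ρ (j + 1)).pos := hmono j.le_succ
  omega

/-- A verifier runs in linear time if a linearly bounded potential decreases along its steps. -/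
theorem isLinearTime_of_potential (inv : List α → V.Config → Prop) (Φ : List α → V.Config → ℕ)
    (k : ℕ) (hinv : ∀ w, inv w V.initConfig) (hΦ : ∀ w, Φ w V.initConfig ≤ k * (w.length + 1))
    (hstep : ∀ (P : V.Prover) (w : List α) (c c' : V.Config), inv w c →
      c' ∈ (V.step P w c).support →
      inv w c' ∧ (Φ w c' < Φ w c ∨ c.state = .accept ∨ c.state = .reject)) :
    V.IsLinearTime := by
  refine ⟨k, fun P w ρ hρ => ?_⟩
  have hhalt : ∀ t, ((ρ t).state = .accept ∨ (ρ t).state = .reject) → ρ (t + 1) = ρ t := by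
    intro t ht
    have := hρ.2 t
    rcases ht with ht | ht <;> simpa [step, ht] using this
  have key : ∀ t, inv w (ρ t) ∧
      (((ρ t).state = .accept ∨ (ρ t).state = .reject) ∨
        Φ w (ρ t) + t ≤ k * (w.length + 1)) := by
    intro t
    induction t with
    | zero => exact ⟨hρ.1 ▸ hinv w, Or.inr (hρ.1 ▸ hΦ w)⟩
    | succ t ih =>
      obtain ⟨h1, h2⟩ := hstep P w _ _ ih.1 (hρ.2 t)
      refine ⟨h1, ?_⟩
      rcases ih.2 with h | h
      · left
        rwa [hhalt t h]
      · rcases h2 with h2 | h2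
        · right
          omega
        · left
          rwa [hhalt t h2]
  set T := k * (w.length + 1)
  rcases (key T).2 with h | h
  · exact h
  -- After `T` steps without halting the potential is 0, and one more step would have to lower it.
  · by_contra hne
    obtain ⟨-, h2⟩ := hstep P w _ _ (key T).1 (hρ.2 T)
    rcases h2 with h2 | h2
    · omega
    · exact hne h2

end PFAVerifier

/-! ### The verifier -/

/-- The phases of a left-to-right scan of a word of the shape
`0 1 0^(b₂) 1 ⋯ 0^(bₗ) 1 1 0^m 1 v`, where `3 ∣ l`, where `b₂, …, bₗ, m` are positive and even, and
where `v` is empty or ends with `1`. -/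
inductive Phase : Type
  /-- nothing has been read -/
  | start
  /-- the word `0` has been read -/
  | startZero
  /-- a block has just ended, and `i` is the number of the blocks so far modulo 3 -/
  | boundary (i : ZMod 3)
  /-- inside a block, with `i` blocks before it and an odd or even number of zeros in it so far -/
  | block (i : ZMod 3) (odd : Bool)
  /-- the doubled `1` has just been read -/
  | middle
  /-- inside the block after the doubled `1` -/
  | lead (odd : Bool)
  /-- after the block that follows the doubled `1`; the last symbol was `prev` -/
  | tail (prev : Bool)
  /-- the word does not have the required shape -/
  | dead
  deriving Fintype, DecidableEq

namespace Phase

/-- The phase after reading one more symbol. -/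
def next : Phase → Bool → Phase
  | start, false => startZero
  | start, true => dead
  | startZero, false => dead
  | startZero, true => boundary 1
  | boundary i, false => block i true
  | boundary i, true => if i = 0 then middle else dead
  | block i odd, false => block i (!odd)
  | block i false, true => boundary (i + 1)
  | block _ true, true => dead
  | middle, false => lead true
  | middle, true => dead
  | lead odd, false => lead (!odd)
  | lead false, true => tail true
  | lead true, true => dead
  | tail _, a => tail a
  | dead, _ => dead

/-- The phase after reading a word. -/
def scan (q : Phase) (w : List Bool) : Phase := w.foldl next q

/-- The phases that follow the doubled `1`. -/
def inSecondPart : Phase → Bool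
  | middle => true
  | lead _ => true
  | tail _ => true
  | _ => false

end Phase

/-- The deterministic tests: each of them scans the input, and expects a certain symbol of the
prover's message along with some of the input symbols. -/
inductive ScanTest : Type
  /-- is the message the input? -/
  | copy
  /-- is each block twice as long as the preceding one in the message, up to the doubled `1`, and
  just as long as the preceding one afterwards? -/
  | double
  /-- does the message, after the doubled `1`, start with as many zeros as there are blocks? -/
  | count
  deriving DecidableEq

instance : Fintype ScanTest := ⟨{.copy, .double, .count}, by rintro (_ | _ | _) <;> simp⟩

namespace ScanTest

/-- The symbol expected from the prover when the symbol `a` is read in the phase `q`. -/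
def expected : ScanTest → Phase → Bool → Option Bool
  | copy, _, a => some a
  | double, .block _ true, false => some false
  | double, .block _ false, true => some true
  | double, .lead true, false => some false
  | double, .lead false, true => some true
  | double, .tail prev, _ => some prev
  | double, _, _ => none
  | count, .middle, _ => none
  | count, .lead _, a => if a then some false else none
  | count, .tail _, a => if a then some false else none
  | count, _, a => some a

/-- Whether a further symbol, `1`, is expected at the end of the input. -/
def expectsLast : ScanTest → Bool
  | copy => false
  | double => true
  | count => true

/-- All the symbols expected from the prover while a word is scanned, up to its end. -/
def transcript (X : ScanTest) : Phase → List Bool → List Bool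
  | _, [] => if X.expectsLast then [true] else []
  | q, a :: w => (X.expected q a).toList ++ transcript X (q.next a) w

end ScanTest

/-- The reading states of the verifier. -/
inductive ScanRead : Type
  | init
  | test (X : ScanTest) (q : Phase)
  /-- the test with the coin; `d` counts the ones received after the doubled `1` -/
  | coin (q : Phase) (d : Fin 8)
  deriving Fintype, DecidableEq

/-- The communicating states of the verifier. -/
inductive ScanQuery : Type
  /-- the symbol `b` is expected, before the test `X` continues in the phase `q` -/
  | expect (X : ScanTest) (b : Bool) (q : Phase)
  /-- the symbol `1` is expected, before the input is accepted -/
  | last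
  /-- the test with the coin continues with the count `d₀` or `d₁` -/
  | tally (q : Phase) (d₀ d₁ : Fin 8)
  deriving Fintype, DecidableEq

/-- The toss of a coin that shows `true` with probability `p`. -/
noncomputable def coinToss (p : unitInterval) : PMF Bool :=
  PMF.ofFintype (fun b => ENNReal.ofReal (if b then p else 1 - p)) (by
    rw [Fintype.sum_bool, ← ENNReal.ofReal_add (by simpa using p.2.1) (by simpa using p.2.2)]
    simp)

/-- The first transition: with probability `1/7` each, one of the three deterministic tests or the
test with the coin starts; otherwise, the verifier rejects. -/
def chooseTest : Fin 7 → VerifierState ScanRead ScanQuery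
  | 0 => .read (.test .copy .start)
  | 1 => .read (.test .double .start)
  | 2 => .read (.test .count .start)
  | 3 => .read (.coin .start 0)
  | _ => .reject

/-- The state in which the test `X` continues in the phase `q`, after having received the given
symbol, if any. -/
def ScanTest.resume (X : ScanTest) (q : Phase) : Option Bool → VerifierState ScanRead ScanQuery
  | none => .read (.test X q)
  | some b => .comm (.expect X b q)

/-- The state of the test with the coin after a toss in the second part. -/
def afterToss (q : Phase) (d : Fin 8) (heads : Bool) : VerifierState ScanRead ScanQuery :=
  if heads then .comm (.tally q d (d + 1)) else .read (.coin q d)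

/-- The transitions of the verifier from the reading states. -/
noncomputable def scanStep (p : unitInterval) :
    ScanRead → TapeSymbol Bool → PMF (VerifierState ScanRead ScanQuery × HeadMove)
  | .init, .leftEnd => (PMF.uniformOfFintype (Fin 7)).map fun i => (chooseTest i, .right)
  | .test X q, .sym a => PMF.pure (X.resume (q.next a) (X.expected q a), .right)
  | .test X q, .rightEnd =>
      PMF.pure (if q = .tail true then (if X.expectsLast then .comm .last else .accept)
        else .reject, .stay)
  | .coin q d, .sym a =>
      if q.inSecondPart then (coinToss p).map fun b => (afterToss (q.next a) d b, .right)
      else PMF.pure (.comm (.tally (q.next a) 0 0), .right)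
  | .coin _ d, .rightEnd => PMF.pure (if d < 4 then .reject else .accept, .stay)
  | _, _ => PMF.pure (.reject, .stay)

/-- The transitions of the verifier from the communicating states. -/
def scanReceive : ScanQuery → Bool → VerifierState ScanRead ScanQuery
  | .expect X b q, b' => if b' = b then .read (.test X q) else .reject
  | .last, b' => if b' then .accept else .reject
  | .tally q d₀ d₁, b' => .read (.coin q (if b' then d₁ else d₀))

theorem not_left_of_scanStep (p : unitInterval) (r : ScanRead) (a : TapeSymbol Bool)
    (s : VerifierState ScanRead ScanQuery) : (s, HeadMove.left) ∉ (scanStep p r a).support := by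
  rcases r with _ | ⟨X, q⟩ | ⟨q, d⟩ <;> rcases a with _ | _ | a <;> simp only [scanStep] <;>
    try split
  all_goals simp

theorem not_right_of_scanStep (p : unitInterval) (r : ScanRead)
    (s : VerifierState ScanRead ScanQuery) :
    (s, HeadMove.right) ∉ (scanStep p r .rightEnd).support := by
  rcases r with _ | ⟨X, q⟩ | ⟨q, d⟩ <;> simp [scanStep]

/-- The verifier: a single sweep from left to right, during which it sends nothing but requests for
the next symbol of the prover's message. -/
noncomputable def scanVerifier (p : unitInterval) : PFAVerifier Bool where
  ReadState := ScanRead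
  CommState := ScanQuery
  Msg := Bool
  finite_readState := inferInstance
  finite_commState := inferInstance
  finite_msg := inferInstance
  nonempty_msg := inferInstance
  init := .init
  readStep := scanStep p
  send _ := false
  receive := scanReceive
  not_left_of_leftEnd r s := not_left_of_scanStep p r _ s
  not_right_of_rightEnd r s := not_right_of_scanStep p r s

/-! ### Head movement and running time -/

theorem tapeCell_append_cons {α : Type} (u : List α) (a : α) (v : List α) :
    tapeCell (u ++ a :: v) (u.length + 1) = .sym a := by
  simp [tapeCell]

theorem tapeCell_length_succ {α : Type} (u : List α) : tapeCell u (u.length + 1) = .rightEnd := by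
  simp [tapeCell]

theorem lt_length_of_tapeCell_ne {α : Type} {w : List α} {p : ℕ} (hp : p ≤ w.length + 1)
    (h : tapeCell w p ≠ .rightEnd) : p ≤ w.length := by
  by_contra hlt
  obtain rfl : p = w.length + 1 := by omega
  exact h (tapeCell_length_succ w)

/-- An upper bound on the remaining number of steps of the verifier. -/
def scanPotential (w : List Bool) (s : VerifierState ScanRead ScanQuery) (pos : ℕ) : ℕ :=
  match s with
  | .read _ => 2 * (w.length + 2 - pos)
  | .comm .last => 1
  | .comm _ => 2 * (w.length + 2 - pos) + 1
  | .accept => 0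
  | .reject => 0

/-- A move to the right releases 2 units, which pays for the unit held by a communicating state. A
step without a move leaves potential at most 1, below the at least 2 units of a reading state. -/
theorem scanStep_pos_potential {p : unitInterval} {r : ScanRead} {w : List Bool} {pos : ℕ}
    (hpos : pos ≤ w.length + 1) {x : VerifierState ScanRead ScanQuery × HeadMove}
    (hx : x ∈ (scanStep p r (tapeCell w pos)).support) :
    pos ≤ x.2.apply pos ∧ x.2.apply pos ≤ w.length + 1 ∧
      scanPotential w x.1 (x.2.apply pos) < scanPotential w (.read r) pos := by
  obtain ⟨s, m⟩ := x
  have hread : ∀ s, scanPotential w s (pos + 1) ≤ 2 * (w.length + 2 - (pos + 1)) + 1 := by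
    rintro (_ | (_ | _ | _) | _ | _) <;> simp [scanPotential]
  have hmove : tapeCell w pos ≠ .rightEnd → m = .right →
      pos ≤ m.apply pos ∧ m.apply pos ≤ w.length + 1 ∧
      scanPotential w s (m.apply pos) < scanPotential w (.read r) pos := by
    rintro hne rfl
    have := lt_length_of_tapeCell_ne hpos hne
    refine ⟨by simp [HeadMove.apply], by simpa [HeadMove.apply] using this, ?_⟩
    refine (hread s).trans_lt ?_
    simp only [scanPotential]
    omega
  have hstay : m = .stay → scanPotential w s pos ≤ 1 → pos ≤ m.apply pos ∧
      m.apply pos ≤ w.length + 1 ∧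
      scanPotential w s (m.apply pos) < scanPotential w (.read r) pos := by
    rintro rfl hs
    refine ⟨le_rfl, hpos, hs.trans_lt ?_⟩
    simp only [scanPotential]
    omega
  rcases hcell : tapeCell w pos with _ | _ | a <;> rw [hcell] at hx hmove <;>
    rcases r with _ | ⟨X, q⟩ | ⟨q, d⟩ <;> simp only [scanStep] at hx
  case rightEnd.test =>
    simp only [PMF.support_pure, Set.mem_singleton_iff, Prod.mk.injEq] at hx
    refine hstay hx.2 ?_
    rw [hx.1]
    split_ifs <;> simp [scanPotential]
  case rightEnd.coin =>
    simp only [PMF.support_pure, Set.mem_singleton_iff, Prod.mk.injEq] at hx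
    refine hstay hx.2 ?_
    rw [hx.1]
    split_ifs <;> simp [scanPotential]
  case leftEnd.init =>
    simp only [PMF.mem_support_map_iff, Prod.mk.injEq] at hx
    obtain ⟨_, -, -, h⟩ := hx
    exact hmove (by simp) h.symm
  case sym.test =>
    simp only [PMF.support_pure, Set.mem_singleton_iff, Prod.mk.injEq] at hx
    exact hmove (by simp) hx.2
  case sym.coin =>
    split at hx
    · simp only [PMF.mem_support_map_iff, Prod.mk.injEq] at hx
      obtain ⟨_, -, -, h⟩ := hx
      exact hmove (by simp) h.symm
    · simp only [PMF.support_pure, Set.mem_singleton_iff, Prod.mk.injEq] at hx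
      exact hmove (by simp) hx.2
  all_goals
    simp only [PMF.support_pure, Set.mem_singleton_iff, Prod.mk.injEq] at hx
    exact hstay hx.2 (by simp [hx.1, scanPotential])

theorem scanReceive_potential (w : List Bool) (c : ScanQuery) (b : Bool) (pos : ℕ) :
    scanPotential w (scanReceive c b) pos < scanPotential w (.comm c) pos := by
  rcases c with ⟨X, b', q⟩ | _ | ⟨q, d, d'⟩ <;> simp only [scanReceive] <;>
    (try split_ifs) <;> simp [scanPotential]

theorem scanVerifier_step {p : unitInterval} {P : (scanVerifier p).Prover} {w : List Bool}
    {c c' : (scanVerifier p).Config} (hc : c.pos ≤ w.length + 1)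
    (hc' : c' ∈ ((scanVerifier p).step P w c).support) :
    c.pos ≤ c'.pos ∧ c'.pos ≤ w.length + 1 ∧
      (scanPotential w c'.state c'.pos < scanPotential w c.state c.pos ∨
        c.state = .accept ∨ c.state = .reject) := by
  obtain ⟨s, pos, l⟩ := c
  rcases s with r | q | _ | _ <;> simp only [PFAVerifier.step] at hc'
  · rw [PMF.mem_support_map_iff] at hc'
    obtain ⟨x, hx, rfl⟩ := hc'
    obtain ⟨h1, h2, h3⟩ := scanStep_pos_potential hc hx
    exact ⟨h1, h2, Or.inl h3⟩
  · rw [PMF.support_pure, Set.mem_singleton_iff] at hc'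
    subst hc'
    exact ⟨le_rfl, hc, Or.inl (scanReceive_potential w q _ pos)⟩
  · rw [PMF.support_pure, Set.mem_singleton_iff] at hc'
    subst hc'
    exact ⟨le_rfl, hc, by simp⟩
  · rw [PMF.support_pure, Set.mem_singleton_iff] at hc'
    subst hc'
    exact ⟨le_rfl, hc, by simp⟩

theorem isSweeping_scanVerifier (p : unitInterval) : (scanVerifier p).IsSweeping := by
  refine PFAVerifier.isSweeping_of_pos_le fun P w c c' hc' => ?_
  rcases c with ⟨r | q | _ | _, pos, l⟩ <;> simp only [PFAVerifier.step] at hc'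
  · rw [PMF.mem_support_map_iff] at hc'
    obtain ⟨⟨s, m⟩, hx, rfl⟩ := hc'
    cases m
    · exact absurd hx (not_left_of_scanStep p r _ s)
    · exact le_rfl
    · exact Nat.le_succ pos
  all_goals
    rw [PMF.support_pure, Set.mem_singleton_iff] at hc'
    subst hc'
    exact le_rfl

theorem isLinearTime_scanVerifier (p : unitInterval) : (scanVerifier p).IsLinearTime := by
  refine PFAVerifier.isLinearTime_of_potential (fun w c => c.pos ≤ w.length + 1)
    (fun w c => scanPotential w c.state c.pos) 4 (fun w => Nat.zero_le _) (fun w => ?_)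
    fun P w c c' hc hc' => (scanVerifier_step hc hc').2
  simp only [PFAVerifier.initConfig, scanPotential]
  omega

/-! ### Block words and their phases -/

theorem zerosOne_zero : zerosOne 0 = [true] := rfl

theorem zerosOne_succ (m : ℕ) : zerosOne (m + 1) = false :: zerosOne m := rfl

theorem length_zerosOne (m : ℕ) : (zerosOne m).length = m + 1 := by simp [zerosOne]

/-- The blocks `0^(2b) 1 0^(4b) 1 ⋯ 0^(2^j b) 1`. -/
def doublingBlocks (b j : ℕ) : List Bool :=
  (List.range j).flatMap fun i => zerosOne (2 ^ (i + 1) * b)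

theorem doublingBlocks_zero (b : ℕ) : doublingBlocks b 0 = [] := rfl

theorem doublingBlocks_succ (b j : ℕ) :
    doublingBlocks b (j + 1) = zerosOne (2 * b) ++ doublingBlocks (2 * b) j := by
  simp only [doublingBlocks, List.range_succ_eq_map, List.flatMap_cons, List.flatMap_map]
  congr 2
  funext i
  congr 1
  simp only [pow_succ]
  ring

theorem zerosOne_append_doublingBlocks (b j : ℕ) :
    zerosOne b ++ doublingBlocks b j =
      (List.range (j + 1)).flatMap fun i => zerosOne (2 ^ i * b) := by
  simp only [doublingBlocks, List.range_succ_eq_map, List.flatMap_cons, List.flatMap_map]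
  simp

theorem flatMap_zerosOne_eq (b j : ℕ) :
    zerosOne b ++ doublingBlocks b j =
      (List.range j).flatMap (fun i => zerosOne (2 ^ i * b)) ++ zerosOne (2 ^ j * b) := by
  rw [zerosOne_append_doublingBlocks, List.range_succ, List.flatMap_append, List.flatMap_singleton]

theorem dima2Word_eq {k j : ℕ} (h : 3 * k = j + 1) :
    dima2Word k = zerosOne 1 ++ (doublingBlocks 1 j ++ true ::
      (List.replicate (2 ^ (j + 1)) (zerosOne (2 ^ (j + 1)))).flatten) := by
  rw [← List.append_assoc, zerosOne_append_doublingBlocks, dima2Word, h]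
  simp

namespace Phase

@[simp]
theorem scan_nil (q : Phase) : q.scan [] = q := rfl

@[simp]
theorem scan_cons (q : Phase) (a : Bool) (w : List Bool) : q.scan (a :: w) = (q.next a).scan w :=
  rfl

@[simp]
theorem scan_dead (w : List Bool) : dead.scan w = dead := by
  induction w with
  | nil => rfl
  | cons a w ih => exact ih

/-- Two zeros restore the phase, and `2 * (a + 1)` unfolds to two more zeros, so the induction step
is definitional. -/
theorem scan_block_zerosOne (i : ZMod 3) (a : ℕ) (t : List Bool) :
    (block i false).scan (zerosOne (2 * a) ++ t) = (boundary (i + 1)).scan t := by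
  induction a with
  | zero => rfl
  | succ a ih => exact ih

theorem scan_lead_zerosOne (a : ℕ) (t : List Bool) :
    (lead false).scan (zerosOne (2 * a) ++ t) = (tail true).scan t := by
  induction a with
  | zero => rfl
  | succ a ih => exact ih

theorem scan_doublingBlocks (i : ZMod 3) {b : ℕ} (hb : 0 < b) (j : ℕ) (t : List Bool) :
    (boundary i).scan (doublingBlocks b j ++ t) = (boundary (i + j)).scan t := by
  induction j generalizing i b with
  | zero => simp [doublingBlocks_zero]
  | succ j ih =>
    -- A positive `b` exposes a first zero, after which `boundary i` and `block i false` have the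
    -- same successor.
    obtain ⟨a, rfl⟩ : ∃ a, b = a + 1 := ⟨b - 1, by omega⟩
    rw [doublingBlocks_succ, List.append_assoc, Nat.cast_add, Nat.cast_one, add_comm (j : ZMod 3),
      ← add_assoc, ← ih (i + 1) (b := 2 * (a + 1)) (by omega)]
    exact scan_block_zerosOne i (a + 1) _

theorem scan_tail_zerosOne (p : Bool) (m : ℕ) (t : List Bool) :
    (tail p).scan (zerosOne m ++ t) = (tail true).scan t := by
  induction m generalizing p with
  | zero => rfl
  | succ m ih => exact ih false

theorem scan_tail_flatten (m r : ℕ) :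
    (tail true).scan (List.replicate r (zerosOne m)).flatten = tail true := by
  induction r with
  | zero => rfl
  | succ r ih => rw [List.replicate_succ, List.flatten_cons, scan_tail_zerosOne, ih]

theorem eq_zero_of_scan_tail_replicate {n : ℕ}
    (h : (tail true).scan (List.replicate n false) = tail true) : n = 0 := by
  have key : ∀ n, (tail false).scan (List.replicate n false) = tail false := by
    intro n
    induction n with
    | zero => rfl
    | succ n ih => exact ih
  cases n with
  | zero => rfl
  | succ n => exact absurd ((key n).symm.trans h) (by decide)

end Phase

/-! ### Symbols requested by the deterministic tests -/

namespace ScanTest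

open Phase

theorem transcript_cons (X : ScanTest) (q : Phase) (a : Bool) (w : List Bool) :
    X.transcript q (a :: w) = (X.expected q a).toList ++ X.transcript (q.next a) w := rfl

theorem transcript_double_block_zerosOne (i : ZMod 3) (a : ℕ) (t : List Bool) :
    double.transcript (block i false) (zerosOne (2 * a) ++ t) =
      zerosOne a ++ double.transcript (boundary (i + 1)) t := by
  induction a with
  | zero => rfl
  | succ a ih => exact congrArg (List.cons false) ih

theorem transcript_double_lead_zerosOne (a : ℕ) (t : List Bool) :
    double.transcript (lead false) (zerosOne (2 * a) ++ t) =
      zerosOne a ++ double.transcript (tail true) t := by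
  induction a with
  | zero => rfl
  | succ a ih => exact congrArg (List.cons false) ih

/-- Two input zeros cost one message zero, so a block of the input is matched with one of half its
length: the message stays one block behind. -/
theorem transcript_double_doublingBlocks (i : ZMod 3) {b : ℕ} (hb : 0 < b) (j : ℕ)
    (t : List Bool) :
    double.transcript (boundary i) (doublingBlocks b j ++ t) =
      (List.range j).flatMap (fun i => zerosOne (2 ^ i * b)) ++
        double.transcript (boundary (i + j)) t := by
  induction j generalizing i b with
  | zero => simp [doublingBlocks_zero]
  | succ j ih =>
    obtain ⟨a, rfl⟩ : ∃ a, b = a + 1 := ⟨b - 1, by omega⟩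
    rw [doublingBlocks_succ, List.append_assoc, Nat.cast_add, Nat.cast_one, add_comm (j : ZMod 3),
      ← add_assoc, ← zerosOne_append_doublingBlocks]
    refine (transcript_double_block_zerosOne i (a + 1) _).trans ?_
    rw [List.append_assoc, ih (i + 1) (by omega), doublingBlocks]
    congr 3
    funext i
    congr 1
    ring

/-- Requesting the previous symbol delays the input by one place; the closing request of
`expectsLast` supplies the final `1`. -/
theorem transcript_double_tail {p : Bool} {v : List Bool} (h : (tail p).scan v = tail true) :
    double.transcript (tail p) v = p :: v := by
  induction v generalizing p with
  | nil =>
    obtain rfl : p = true := by simpa using h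
    rfl
  | cons a v ih => exact congrArg (List.cons p) (ih h)

theorem transcript_count_block_zerosOne (i : ZMod 3) (a : ℕ) (t : List Bool) :
    count.transcript (block i false) (zerosOne (2 * a) ++ t) =
      zerosOne (2 * a) ++ count.transcript (boundary (i + 1)) t := by
  induction a with
  | zero => rfl
  | succ a ih => exact congrArg (fun l => false :: false :: l) ih

theorem transcript_count_lead_zerosOne (a : ℕ) (t : List Bool) :
    count.transcript (lead false) (zerosOne (2 * a) ++ t) =
      false :: count.transcript (tail true) t := by
  induction a with
  | zero => rfl
  | succ a ih => exact ih

theorem transcript_count_doublingBlocks (i : ZMod 3) {b : ℕ} (hb : 0 < b) (j : ℕ)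
    (t : List Bool) :
    count.transcript (boundary i) (doublingBlocks b j ++ t) =
      doublingBlocks b j ++ count.transcript (boundary (i + j)) t := by
  induction j generalizing i b with
  | zero => simp [doublingBlocks_zero]
  | succ j ih =>
    obtain ⟨a, rfl⟩ : ∃ a, b = a + 1 := ⟨b - 1, by omega⟩
    rw [doublingBlocks_succ, List.append_assoc, Nat.cast_add, Nat.cast_one, add_comm (j : ZMod 3),
      ← add_assoc, List.append_assoc, ← ih (i + 1) (by omega)]
    exact transcript_count_block_zerosOne i (a + 1) _

theorem transcript_count_tail_zerosOne (p : Bool) (m : ℕ) (t : List Bool) :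
    count.transcript (tail p) (zerosOne m ++ t) = false :: count.transcript (tail true) t := by
  induction m generalizing p with
  | zero => rfl
  | succ m ih => exact ih false

/-- Each block costs one zero, requested at its `1`; the closing `1` comes from `expectsLast`. -/
theorem transcript_count_tail_flatten (m r : ℕ) :
    count.transcript (tail true) (List.replicate r (zerosOne m)).flatten = zerosOne r := by
  induction r with
  | zero => rfl
  | succ r ih =>
    rw [List.replicate_succ, List.flatten_cons, transcript_count_tail_zerosOne, ih, zerosOne_succ]

theorem transcript_copy (q : Phase) (w : List Bool) : copy.transcript q w = w := by
  induction w generalizing q with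
  | nil => rfl
  | cons a w ih => exact congrArg (List.cons a) (ih _)

/-! ### Words that pass the tests -/

/-- The scan excludes odd blocks and truncated words; the prefix condition excludes even blocks of
the wrong length. -/
theorem block_prefix {i : ZMod 3} {a : ℕ} {t x : List Bool}
    (hs : (block i false).scan t = tail true)
    (ht : double.transcript (block i false) t <+: zerosOne a ++ x) :
    ∃ t', t = zerosOne (2 * a) ++ t' ∧ (boundary (i + 1)).scan t' = tail true ∧
      double.transcript (boundary (i + 1)) t' <+: x := by
  induction a generalizing t with
  | zero =>
    rcases t with _ | ⟨_ | _, t⟩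
    · exact absurd hs (by simp)
    · rcases t with _ | ⟨_ | _, t⟩
      · exact absurd hs (by simp [next])
      · simp [transcript_cons, expected, next, zerosOne_zero] at ht
      · simp [next] at hs
    · exact ⟨t, rfl, hs, by simpa [transcript_cons, expected, next, zerosOne_zero] using ht⟩
  | succ a ih =>
    rcases t with _ | ⟨_ | _, t⟩
    · exact absurd hs (by simp)
    · rcases t with _ | ⟨_ | _, t⟩
      · exact absurd hs (by simp [next])
      · obtain ⟨t', rfl, h⟩ := ih (t := t) hs
          (by simpa [transcript_cons, expected, next, zerosOne_succ] using ht)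
        exact ⟨t', rfl, h⟩
      · simp [next] at hs
    · simp [transcript_cons, expected, next, zerosOne_succ] at ht

theorem lead_prefix {a : ℕ} {t x : List Bool}
    (hs : (lead false).scan t = tail true)
    (ht : double.transcript (lead false) t <+: zerosOne a ++ x) :
    ∃ t', t = zerosOne (2 * a) ++ t' ∧ (tail true).scan t' = tail true ∧
      double.transcript (tail true) t' <+: x := by
  induction a generalizing t with
  | zero =>
    rcases t with _ | ⟨_ | _, t⟩
    · exact absurd hs (by simp)
    · rcases t with _ | ⟨_ | _, t⟩
      · exact absurd hs (by simp [next])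
      · simp [transcript_cons, expected, next, zerosOne_zero] at ht
      · simp [next] at hs
    · exact ⟨t, rfl, hs, by simpa [transcript_cons, expected, next, zerosOne_zero] using ht⟩
  | succ a ih =>
    rcases t with _ | ⟨_ | _, t⟩
    · exact absurd hs (by simp)
    · rcases t with _ | ⟨_ | _, t⟩
      · exact absurd hs (by simp [next])
      · obtain ⟨t', rfl, h⟩ := ih (t := t) hs
          (by simpa [transcript_cons, expected, next, zerosOne_succ] using ht)
        exact ⟨t', rfl, h⟩
      · simp [next] at hs
    · simp [transcript_cons, expected, next, zerosOne_succ] at ht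

/-- The message is the input itself, one block behind. Once `t = 0^(2b) 1 t'` is matched against
`0^b 1`, the rest of the message is `0^(2b) 1 t' z`, the same situation with `2b` for `b`. The word
`z` is whatever the message contains beyond the input. -/
theorem boundary_prefix (n : ℕ) {i : ZMod 3} {b : ℕ} {t z : List Bool} (hn : t.length ≤ n)
    (hs : (boundary i).scan t = tail true)
    (ht : double.transcript (boundary i) t <+: zerosOne b ++ (t ++ z)) :
    ∃ j t', t = doublingBlocks b j ++ true :: t' ∧ i + (j : ZMod 3) = 0 ∧
      middle.scan t' = tail true ∧
      double.transcript middle t' <+: zerosOne (2 ^ j * b) ++ true :: (t' ++ z) := by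
  induction n generalizing i b t with
  | zero =>
    obtain rfl : t = [] := by simpa using hn
    exact absurd hs (by simp)
  | succ n ih =>
    rcases t with _ | ⟨_ | _, t⟩
    · exact absurd hs (by simp)
    · obtain ⟨t', h1, h2, h3⟩ := block_prefix (i := i) (t := false :: t) hs ht
      rw [h1, List.append_assoc] at h3
      have hlen : t'.length ≤ n := by
        have := congrArg List.length h1
        simp only [List.length_cons, List.length_append, length_zerosOne] at this hn
        omega
      obtain ⟨j, t'', rfl, h5, h6, h7⟩ := ih hlen h2 h3
      refine ⟨j + 1, t'', ?_, ?_, h6, ?_⟩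
      · rw [h1, doublingBlocks_succ, List.append_assoc]
      · rw [← h5]
        push_cast
        ring
      · rwa [pow_succ, mul_assoc]
    · by_cases hi : i = 0
      · subst hi
        exact ⟨0, t, rfl, by simp, hs, by simpa [transcript_cons, expected, next] using ht⟩
      · exact absurd hs (by simp [next, hi])

/-- A prefix of `0^m 1 v z` either starts with `0^m 1`, and the remainder satisfies the same
hypotheses, or is a prefix of `0^m 1`. In the latter case it is the whole block or consists of
zeros, and then ending in `tail true` makes it empty. -/
theorem eq_flatten_of_prefix (n : ℕ) {m : ℕ} {v z : List Bool} (hn : v.length ≤ n)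
    (hs : (tail true).scan v = tail true) (hv : v <+: zerosOne m ++ (v ++ z)) :
    ∃ r, v = (List.replicate r (zerosOne m)).flatten := by
  induction n generalizing v with
  | zero => exact ⟨0, by simpa using hn⟩
  | succ n ih =>
    rcases List.prefix_or_prefix_of_prefix (List.prefix_append (zerosOne m) (v ++ z)) hv
      with h | h
    · obtain ⟨v', rfl⟩ := h
      have hlen : v'.length ≤ n := by
        simp only [List.length_append, length_zerosOne] at hn
        omega
      rw [List.prefix_append_right_inj, List.append_assoc] at hv
      rw [scan_tail_zerosOne] at hs
      obtain ⟨r, rfl⟩ := ih hlen hs hv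
      exact ⟨r + 1, rfl⟩
    · rw [zerosOne, List.prefix_concat_iff] at h
      rcases h with h | h
      · exact ⟨1, by rw [h]; simp [zerosOne]⟩
      · obtain ⟨-, hv'⟩ := List.prefix_replicate_iff.1 h
        rw [hv'] at hs
        exact ⟨0, List.length_eq_zero_iff.1 (eq_zero_of_scan_tail_replicate hs)⟩

theorem zerosOne_prefix_zerosOne {a b : ℕ} {x : List Bool}
    (h : zerosOne a <+: zerosOne b ++ x) : a = b := by
  induction a generalizing b with
  | zero =>
    cases b with
    | zero => rfl
    | succ b => simp [zerosOne_zero, zerosOne_succ] at h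
  | succ a ih =>
    cases b with
    | zero => simp [zerosOne_zero, zerosOne_succ] at h
    | succ b => rw [ih (b := b) (by simpa [zerosOne_succ] using h)]

/-- A word that passes the tests is a member of `DIMA2`. -/
theorem mem_DIMA2_of_transcript_prefix {w z z' : List Bool} (hs : Phase.start.scan w = tail true)
    (hd : double.transcript .start w <+: w ++ z) (hc : count.transcript .start w <+: w ++ z') :
    ∃ k, 0 < k ∧ w = dima2Word k := by
  rcases w with _ | ⟨_ | _, _ | ⟨_ | _, w⟩⟩
  · exact absurd hs (by simp)
  · exact absurd hs (by simp [next])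
  · exact absurd hs (by simp [next])
  · obtain ⟨j, t, rfl, h1, h2, h3⟩ := boundary_prefix (b := 1) w.length le_rfl hs hd
    rcases t with _ | ⟨_ | _, t⟩
    · exact absurd h2 (by simp)
    · obtain ⟨v, h4, h5, h6⟩ := lead_prefix (t := false :: t) h2 h3
      -- The pending message symbol is the doubled `1`; without it, `v` is a prefix of `0^m 1 v z`.
      rw [transcript_double_tail h5, h4, List.cons_prefix_cons, List.append_assoc] at h6
      obtain ⟨r, rfl⟩ := eq_flatten_of_prefix v.length le_rfl h5 h6.2
      have hpow : 2 * (2 ^ j * 1) = 2 ^ (j + 1) := by ring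
      rw [hpow] at h4
      have hj : 3 ∣ j + 1 := by
        have : ((j + 1 : ℕ) : ZMod 3) = 0 := by
          rw [← h1]
          push_cast
          ring
        exact (ZMod.natCast_eq_zero_iff _ _).1 this
      obtain ⟨k, hk⟩ := hj
      refine ⟨k, by omega, ?_⟩
      have hlead : count.transcript middle (false :: t) = zerosOne (r + 1) := by
        have : count.transcript middle (false :: t) = count.transcript (lead false) (false :: t) :=
          rfl
        rw [this, h4, pow_succ', transcript_count_lead_zerosOne, transcript_count_tail_flatten,
          zerosOne_succ]
      have hcount : count.transcript .start
          (false :: true :: (doublingBlocks 1 j ++ true :: false :: t)) =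
          false :: true :: (doublingBlocks 1 j ++ true :: zerosOne (r + 1)) := by
        rw [← hlead]
        refine congrArg (fun l => false :: true :: l)
          ((transcript_count_doublingBlocks 1 one_pos j _).trans ?_)
        rw [h1]
        rfl
      -- The message shows the first block after the doubled `1` where `count` requests `0^(r+1) 1`.
      have hr : r + 1 = 2 ^ (j + 1) := by
        rw [hcount, h4] at hc
        simp only [List.cons_append, List.cons_prefix_cons, true_and, List.append_assoc,
          List.prefix_append_right_inj] at hc
        exact zerosOne_prefix_zerosOne hc
      rw [dima2Word_eq hk.symm, h4, ← hr, List.replicate_succ, List.flatten_cons]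
      rfl
    · exact absurd h2 (by simp [next])
  · exact absurd hs (by simp [next])
  · exact absurd hs (by simp [next])
  · exact absurd hs (by simp [next])

/-! ### Members of `DIMA2` pass the tests -/

theorem scan_boundary_dima2 (i : ZMod 3) {j : ℕ} (hj : i + j = 0) (r : ℕ) :
    (boundary i).scan (doublingBlocks 1 j ++ true ::
      (List.replicate (r + 1) (zerosOne (2 ^ (j + 1)))).flatten) = tail true := by
  rw [scan_doublingBlocks i one_pos, hj, List.replicate_succ, List.flatten_cons, pow_succ',
    ← scan_tail_flatten (2 * 2 ^ j) r, ← scan_lead_zerosOne (2 ^ j)]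
  -- This exposes a first zero, after which `middle` and `lead false` coincide.
  obtain ⟨a, ha⟩ : ∃ a, 2 ^ j = a + 1 := ⟨2 ^ j - 1, by have := Nat.two_pow_pos j; omega⟩
  rw [ha]
  rfl

/-- Being one block behind, the test requests the member without its last block. -/
theorem transcript_double_boundary_dima2 (i : ZMod 3) {j : ℕ} (hj : i + j = 0) (r : ℕ) :
    double.transcript (boundary i) (doublingBlocks 1 j ++ true ::
      (List.replicate (r + 1) (zerosOne (2 ^ (j + 1)))).flatten) =
    zerosOne 1 ++ (doublingBlocks 1 j ++
      true :: (List.replicate r (zerosOne (2 ^ (j + 1)))).flatten) := by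
  rw [transcript_double_doublingBlocks i one_pos, hj, ← List.append_assoc, flatMap_zerosOne_eq,
    List.append_assoc, mul_one, ← transcript_double_tail (scan_tail_flatten _ r),
    ← transcript_double_lead_zerosOne, ← pow_succ', List.replicate_succ, List.flatten_cons]
  obtain ⟨a, ha⟩ : ∃ a, 2 ^ (j + 1) = a + 1 :=
    ⟨2 ^ (j + 1) - 1, by have := Nat.two_pow_pos (j + 1); omega⟩
  rw [ha]
  rfl

theorem transcript_count_boundary_dima2 (i : ZMod 3) {j : ℕ} (hj : i + j = 0) (r : ℕ) :
    count.transcript (boundary i) (doublingBlocks 1 j ++ true ::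
      (List.replicate (r + 1) (zerosOne (2 ^ (j + 1)))).flatten) =
    doublingBlocks 1 j ++ true :: zerosOne (r + 1) := by
  rw [transcript_count_doublingBlocks i one_pos, hj, zerosOne_succ,
    ← transcript_count_tail_flatten (2 ^ (j + 1)) r, List.replicate_succ, List.flatten_cons,
    ← transcript_count_lead_zerosOne (2 ^ j), ← pow_succ']
  obtain ⟨a, ha⟩ : ∃ a, 2 ^ (j + 1) = a + 1 :=
    ⟨2 ^ (j + 1) - 1, by have := Nat.two_pow_pos (j + 1); omega⟩
  rw [ha]
  rfl

/-- The members of `DIMA2` pass the tests. -/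
theorem dima2Word_scan_transcript {k : ℕ} (hk : 0 < k) :
    Phase.start.scan (dima2Word k) = tail true ∧
      ∀ X : ScanTest, X.transcript .start (dima2Word k) <+: dima2Word k := by
  obtain ⟨j, hj⟩ : ∃ j, 3 * k = j + 1 := ⟨3 * k - 1, by omega⟩
  obtain ⟨r, hr⟩ : ∃ r, 2 ^ (j + 1) = r + 1 :=
    ⟨2 ^ (j + 1) - 1, by have := Nat.two_pow_pos (j + 1); omega⟩
  have h0 : (1 : ZMod 3) + j = 0 := by
    have : ((j + 1 : ℕ) : ZMod 3) = 0 := (ZMod.natCast_eq_zero_iff _ _).2 ⟨k, hj.symm⟩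
    rw [← this]
    push_cast
    ring
  have hw : dima2Word k = false :: true :: (doublingBlocks 1 j ++ true ::
      (List.replicate (r + 1) (zerosOne (2 ^ (j + 1)))).flatten) := by
    rw [dima2Word_eq hj, hr]
    rfl
  refine ⟨?_, ?_⟩
  · rw [hw]
    exact scan_boundary_dima2 1 h0 r
  · rintro (_ | _ | _)
    · rw [transcript_copy]
    · have : double.transcript .start (dima2Word k) = false :: true :: (doublingBlocks 1 j ++
          true :: (List.replicate r (zerosOne (2 ^ (j + 1)))).flatten) := by
        rw [hw]
        exact transcript_double_boundary_dima2 1 h0 r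
      rw [this, hw, List.replicate_succ', List.flatten_append]
      exact ⟨zerosOne (2 ^ (j + 1)), by simp⟩
    · have : count.transcript .start (dima2Word k) = false :: true :: (doublingBlocks 1 j ++
          true :: zerosOne (r + 1)) := by
        rw [hw]
        exact congrArg (fun l => false :: true :: l) (transcript_count_boundary_dima2 1 h0 r)
      rw [this, hw, List.replicate_succ, List.flatten_cons, hr]
      exact ⟨(List.replicate r (zerosOne (r + 1))).flatten, by simp⟩

end ScanTest

/-! ### The prover's message and the deterministic tests -/

/-- The message `y`, from its symbol number `j` on, starts with the given word. -/
def Follows (y : ℕ → Bool) : ℕ → List Bool → Prop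
  | _, [] => True
  | j, b :: l => y j = b ∧ Follows y (j + 1) l

theorem follows_append {y : ℕ → Bool} {j : ℕ} {l l' : List Bool} :
    Follows y j (l ++ l') ↔ Follows y j l ∧ Follows y (j + l.length) l' := by
  induction l generalizing j with
  | nil => simp [Follows]
  | cons b l ih =>
    simp only [List.cons_append, Follows, ih, List.length_cons, and_assoc, add_assoc,
      add_comm 1]

theorem Follows.of_prefix {y : ℕ → Bool} {j : ℕ} {l l' : List Bool} (h : Follows y j l')
    (hl : l <+: l') : Follows y j l := by
  obtain ⟨x, rfl⟩ := hl
  exact (follows_append.1 h).1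

theorem Follows.eq_of_getElem? {y : ℕ → Bool} {j : ℕ} {l : List Bool} (h : Follows y j l)
    {i : ℕ} {b : Bool} (hb : l[i]? = some b) : y (j + i) = b := by
  induction l generalizing i j with
  | nil => simp at hb
  | cons a l ih =>
    cases i with
    | zero => exact h.1.trans (by simpa using hb)
    | succ i =>
      rw [← ih h.2 (i := i) (by simpa using hb)]
      congr 1
      omega

theorem follows_of_getD (j : ℕ) (u v : List Bool) (hu : u.length = j) :
    Follows (fun n => (u ++ v).getD n false) j v := by
  induction v generalizing u j with
  | nil => trivial
  | cons b v ih =>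
    refine ⟨by simp [← hu], ?_⟩
    have := ih (j + 1) (u ++ [b]) (by simp [hu])
    simpa using this

/-- Two words read at the same place of one message are comparable; `z` covers the case of the
longer `l`. -/
theorem Follows.exists_prefix {y : ℕ → Bool} {j : ℕ} {w l : List Bool} (hw : Follows y j w)
    (hl : Follows y j l) : ∃ z, l <+: w ++ z := by
  induction w generalizing j l with
  | nil => exact ⟨l, List.prefix_refl l⟩
  | cons a w ih =>
    cases l with
    | nil => exact ⟨[], List.nil_prefix⟩
    | cons b l =>
      obtain ⟨z, hz⟩ := ih hw.2 hl.2
      exact ⟨z, by rw [List.cons_append, List.cons_prefix_cons]; exact ⟨hl.1.symm.trans hw.1, hz⟩⟩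

section

variable {p : unitInterval} (P : (scanVerifier p).Prover) (w : List Bool)

/-- The message of the prover, as a response to a verifier that only sends requests. -/
def proverMessage (n : ℕ) : Bool := P w (List.replicate (n + 1) false)

/-- The configuration after `j` requests. -/
def scanConfig (p : unitInterval) (s : VerifierState ScanRead ScanQuery) (pos j : ℕ) :
    (scanVerifier p).Config :=
  ⟨s, pos, List.replicate j false⟩

variable {P w} {s : VerifierState ScanRead ScanQuery}

/-- The prover sees only the number of requests, so its answer is a fixed symbol of `proverMessage`,
independent of the test and of the coin. -/
theorem hitFrom_query (hs : s = .accept ∨ s = .reject) (c : ScanQuery) (pos j : ℕ) :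
    (scanVerifier p).hitFrom P w s
        (scanConfig p (scanReceive c (proverMessage P w j)) pos (j + 1)) ≤
      (scanVerifier p).hitFrom P w s (scanConfig p (.comm c) pos j) :=
  PFAVerifier.hitFrom_le_of_step_eq_pure hs rfl

theorem hitFrom_read (hs : s = .accept ∨ s = .reject) {r : ScanRead} {pos j : ℕ}
    {x : VerifierState ScanRead ScanQuery × HeadMove}
    (h : scanStep p r (tapeCell w pos) = PMF.pure x) :
    (scanVerifier p).hitFrom P w s (scanConfig p x.1 (x.2.apply pos) j) ≤
      (scanVerifier p).hitFrom P w s (scanConfig p (.read r) pos j) :=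
  PFAVerifier.hitFrom_le_of_step_eq_pure hs (PFAVerifier.step_read_pure h)

open Classical in
/-- The state in which a deterministic test ends. -/
noncomputable def testResult (y : ℕ → Bool) (X : ScanTest) (q : Phase) (j : ℕ) (v : List Bool) :
    VerifierState ScanRead ScanQuery :=
  if q.scan v = .tail true ∧ Follows y j (X.transcript q v) then .accept else .reject

theorem testResult_halts (y : ℕ → Bool) (X : ScanTest) (q : Phase) (j : ℕ) (v : List Bool) :
    testResult y X q j v = .accept ∨ testResult y X q j v = .reject := by
  unfold testResult
  split_ifs <;> simp

open Classical in
-- Against a fixed message the test is deterministic: induction along the unread input, one request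
-- per expected symbol, with a rejection at the first mismatch.
theorem one_le_hitFrom_test (X : ScanTest) (q : Phase) (j : ℕ) (u v : List Bool)
    (hw : w = u ++ v) :
    1 ≤ (scanVerifier p).hitFrom P w (testResult (proverMessage P w) X q j v)
      (scanConfig p (.read (.test X q)) (u.length + 1) j) := by
  induction v generalizing q j u with
  | nil =>
    have hcell : tapeCell w (u.length + 1) = .rightEnd := by
      rw [hw, List.append_nil, tapeCell_length_succ]
    refine le_trans ?_ (hitFrom_read (testResult_halts _ _ _ _ _) (by rw [hcell]; rfl))
    by_cases hq : q = .tail true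
    · cases hX : X.expectsLast
      · exact PFAVerifier.hitFrom_of_state_eq
          (by simp [scanConfig, testResult, hq, hX, ScanTest.transcript, Follows]; rfl)
      · simp only [hq, if_true]
        refine le_trans ?_ (hitFrom_query (testResult_halts _ _ _ _ _) _ _ _)
        refine PFAVerifier.hitFrom_of_state_eq ?_
        simp [scanConfig, testResult, hX, ScanTest.transcript, Follows, scanReceive]
        rfl
    · exact PFAVerifier.hitFrom_of_state_eq (by simp [scanConfig, testResult, hq]; rfl)
  | cons a v ih =>
    have hcell : tapeCell w (u.length + 1) = .sym a := by
      rw [hw, tapeCell_append_cons]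
    refine le_trans ?_ (hitFrom_read (testResult_halts _ _ _ _ _) (by rw [hcell]; rfl))
    have hw' : w = (u ++ [a]) ++ v := by rw [hw, List.append_assoc]; rfl
    have hpos : (HeadMove.right).apply (u.length + 1) = (u ++ [a]).length + 1 := by
      simp [HeadMove.apply]
    rw [hpos]
    cases hX : X.expected q a with
    | none =>
      have : testResult (proverMessage P w) X q j (a :: v) =
          testResult (proverMessage P w) X (q.next a) j v := by
        unfold testResult
        exact if_congr (by simp [ScanTest.transcript, hX]) rfl rfl
      rw [this]
      exact ih (q.next a) j (u ++ [a]) hw'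
    | some b =>
      refine le_trans ?_ (hitFrom_query (testResult_halts _ _ _ _ _) _ _ _)
      by_cases hb : proverMessage P w j = b
      · have : testResult (proverMessage P w) X q j (a :: v) =
            testResult (proverMessage P w) X (q.next a) (j + 1) v := by
          unfold testResult
          exact if_congr (by simp [ScanTest.transcript, hX, Follows, hb]) rfl rfl
        rw [this]
        simp only [scanReceive, hb, if_true]
        exact ih (q.next a) (j + 1) (u ++ [a]) hw'
      · have : testResult (proverMessage P w) X q j (a :: v) = .reject :=
          if_neg (by simp [ScanTest.transcript, hX, Follows, hb])
        rw [this]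
        exact PFAVerifier.hitFrom_of_state_eq (by simp [scanConfig, hb, scanReceive]; rfl)

/-! ### The test with the coin -/

/-- The phase `middle` is entered only from the first part, so a scan still to end there has not yet
left the first part. -/
theorem scan_ne_middle_of_inSecondPart {q : Phase} (hq : q.inSecondPart = true ∨ q = .dead)
    {v : List Bool} (a : Bool) : (q.next a).scan v ≠ .middle := by
  have key : ∀ q : Phase, q.inSecondPart = true ∨ q = .dead → ∀ a : Bool,
      q.next a ≠ .middle ∧ ((q.next a).inSecondPart = true ∨ q.next a = .dead) := by
    rintro (_ | _ | _ | _ | _ | (_ | _) | _ | _) h (_ | _) <;>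
      simp_all [Phase.inSecondPart, Phase.next]
  induction v generalizing q a with
  | nil => exact (key q hq a).1
  | cons b v ih => exact ih (key q hq a).2 b

theorem inSecondPart_next {q : Phase} {a : Bool} {v : List Bool} (hq : q.inSecondPart = true)
    (h : (q.next a).scan v = .tail true) : (q.next a).inSecondPart = true := by
  rcases q with _ | _ | _ | _ | _ | (_ | _) | _ | _ <;> rcases a with _ | _ <;>
    simp_all [Phase.inSecondPart, Phase.next]

/-- During the first part, the test with the coin requests one symbol per input symbol. -/
theorem hitFrom_coin_firstPart (hs : s = .accept ∨ s = .reject) (q : Phase) (u v t : List Bool)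
    (hw : w = u ++ (v ++ t)) (j : ℕ) (hq : q.scan v = .middle) :
    (scanVerifier p).hitFrom P w s
        (scanConfig p (.read (.coin .middle 0)) ((u ++ v).length + 1) (j + v.length)) ≤
      (scanVerifier p).hitFrom P w s
        (scanConfig p (.read (.coin q 0)) (u.length + 1) j) := by
  induction v generalizing q u j with
  | nil =>
    obtain rfl : q = .middle := hq
    simp
  | cons a v ih =>
    have hcell : tapeCell w (u.length + 1) = .sym a := by
      rw [hw, List.cons_append, tapeCell_append_cons]
    have hq' : q.inSecondPart = false := by
      by_contra h
      exact scan_ne_middle_of_inSecondPart (Or.inl (by simpa using h)) a hq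
    refine le_trans ?_ (hitFrom_read hs (r := .coin q 0) (j := j)
      (x := (.comm (.tally (q.next a) 0 0), .right)) (by rw [hcell]; simp [scanStep, hq']))
    refine le_trans ?_ (hitFrom_query hs _ _ _)
    have := ih (q.next a) (u ++ [a]) (by rw [hw]; simp) (j + 1) hq
    simpa [scanReceive, HeadMove.apply, add_assoc, add_comm 1] using this

theorem hitFrom_coin_toss (hs : s = .accept ∨ s = .reject) {q : Phase} {d : Fin 8} {a : Bool}
    {pos j : ℕ} (hcell : tapeCell w pos = .sym a) (hq : q.inSecondPart = true) :
    ENNReal.ofReal p * (scanVerifier p).hitFrom P w s (scanConfig p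
          (.read (.coin (q.next a) (if proverMessage P w j then d + 1 else d))) (pos + 1) (j + 1)) +
        ENNReal.ofReal (1 - p) * (scanVerifier p).hitFrom P w s
          (scanConfig p (.read (.coin (q.next a) d)) (pos + 1) j) ≤
      (scanVerifier p).hitFrom P w s (scanConfig p (.read (.coin q d)) pos j) := by
  have hstep : scanStep p (.coin q d) (tapeCell w pos) =
      (coinToss p).map fun b => (afterToss (q.next a) d b, .right) := by
    rw [hcell]
    simp [scanStep, hq]
  refine le_trans ?_ (PFAVerifier.sum_hitFrom_le hs
    (PFAVerifier.step_read (V := scanVerifier p) hstep))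
  rw [Fintype.sum_bool]
  refine add_le_add (mul_le_mul' (by simp [coinToss]) (hitFrom_query hs _ _ _))
    (mul_le_mul' (by simp [coinToss]) le_rfl)

/-- Chebyshev's inequality for the test with the coin: `h` is the number of heads so far, `K` is the
length of a block in the second part, and `M` is a number such that the test has the intended
result if the number of heads will differ from `M` by less than `K`. -/
theorem le_hitFrom_coin (hs : s = .accept ∨ s = .reject) {K : ℕ} (hK : 0 < K) {M : ℝ} {N j : ℕ}
    (hy : ∀ i < N, proverMessage P w (j + i) = decide (K ∣ i + 1))
    (hM : ∀ h : ℕ, |(h : ℝ) - M| < K → (if h / K % 8 < 4 then .reject else .accept) = s)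
    (q : Phase) (hq : q.inSecondPart = true) (u v : List Bool) (hw : w = u ++ v)
    (hv : q.scan v = .tail true) (h : ℕ) (hN : h + v.length ≤ N) (d : Fin 8)
    (hd : d.val = h / K % 8) :
    ENNReal.ofReal
        (1 - ((h + v.length * p - M) ^ 2 + v.length * (p * (1 - p))) / (K : ℝ) ^ 2) ≤
      (scanVerifier p).hitFrom P w s
        (scanConfig p (.read (.coin q d)) (u.length + 1) (j + h)) := by
  have hK' : (0 : ℝ) < K := by exact_mod_cast hK
  induction v generalizing q u h d with
  | nil =>
    have hcell : tapeCell w (u.length + 1) = .rightEnd := by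
      rw [hw, List.append_nil, tapeCell_length_succ]
    -- Near `M` the result is right; elsewhere the claimed bound is not positive.
    by_cases hd' : |(h : ℝ) - M| < K
    · refine le_trans ?_ (hitFrom_read hs (r := .coin q d) (j := j + h) (by rw [hcell]; rfl))
      refine le_trans ?_ (PFAVerifier.hitFrom_of_state_eq ?_)
      · rw [← ENNReal.ofReal_one]
        refine ENNReal.ofReal_le_ofReal (sub_le_self _ ?_)
        simp only [List.length_nil, Nat.cast_zero, zero_mul, add_zero]
        positivity
      · rw [← hM h hd', ← hd]
        rfl
    · rw [ENNReal.ofReal_of_nonpos]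
      · exact zero_le
      · rw [sub_nonpos, one_le_div (by positivity)]
        simp only [List.length_nil, Nat.cast_zero, zero_mul, add_zero]
        exact sq_le_sq.2 (by rw [abs_of_pos hK']; exact not_lt.1 hd')
  | cons a v ih =>
    have hcell : tapeCell w (u.length + 1) = .sym a := by
      rw [hw, tapeCell_append_cons]
    have hw' : w = (u ++ [a]) ++ v := by rw [hw, List.append_assoc]; rfl
    have hlen : (u ++ [a]).length = u.length + 1 := by simp
    have hq' := inSecondPart_next hq hv
    rw [List.length_cons] at hN ⊢
    refine le_trans ?_ (hitFrom_coin_toss hs hcell hq)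
    have htails := ih (q.next a) hq' (u ++ [a]) hw' hv h (by omega) d hd
    have hheads := ih (q.next a) hq' (u ++ [a]) hw' hv (h + 1) (by omega)
      (if proverMessage P w (j + h) then d + 1 else d) (by
        -- The quotient `h / K` grows exactly when `K ∣ h + 1`, that is, when the symbol fetched is
        -- a `1`.
        rw [hy h (by omega), Nat.succ_div]
        by_cases hdvd : K ∣ h + 1
        · simp only [hdvd, decide_true, if_true, Fin.val_add, hd]
          simp
        · simp [hdvd, hd])
    rw [hlen] at htails hheads
    refine le_trans ?_ (add_le_add (mul_le_mul_right hheads _) (mul_le_mul_right htails _))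
    rw [← ENNReal.ofReal_mul p.2.1, ← ENNReal.ofReal_mul (sub_nonneg.2 p.2.2)]
    -- The bound is `1 - E[(H - M)²] / K²` for the final number `H` of heads, with second moment
    -- split into squared bias and variance; averaging over one toss preserves it.
    refine le_trans (ENNReal.ofReal_le_ofReal (le_of_eq ?_)) ENNReal.ofReal_add_le
    push_cast
    field_simp
    ring

end

/-! ### Octal digits of the bias, and the coin on members of `DIMA2` -/

/-- The octal digits of the bias of the coin. -/
noncomputable def biasDigit (I : Set ℕ+) (i : ℕ) : Fin 8 :=
  open Classical in if i.succPNat ∈ I then 5 else 1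

/-- The bias of the coin. -/
noncomputable def bias (I : Set ℕ+) : unitInterval :=
  ⟨Real.ofDigits (biasDigit I), Real.ofDigits_nonneg _, Real.ofDigits_le_one _⟩

/-- Multiplication by `b^(i+1)` moves digit `i` to the units place; the remaining digits form `r`.
-/
theorem exists_pow_mul_ofDigits {b : ℕ} (a : ℕ → Fin b) (hb : 0 < b) (i : ℕ) :
    ∃ (A : ℕ) (r : ℝ), 0 ≤ r ∧ r ≤ 1 ∧
      (b : ℝ) ^ (i + 1) * Real.ofDigits a = b * A + (a i : ℕ) + r := by
  have hb' : (b : ℝ) ≠ 0 := by positivity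
  have hsum : ∃ A : ℕ, (b : ℝ) ^ (i + 1) * ∑ l ∈ Finset.range (i + 1), Real.ofDigitsTerm a l =
      b * A + (a i : ℕ) := by
    induction i with
    | zero =>
      refine ⟨0, ?_⟩
      simp only [zero_add, Finset.sum_range_one, Real.ofDigitsTerm]
      field_simp
      simp
    | succ i ih =>
      obtain ⟨A, hA⟩ := ih
      refine ⟨b * A + a i, ?_⟩
      rw [Finset.sum_range_succ, mul_add, pow_succ', mul_assoc, hA, Real.ofDigitsTerm]
      push_cast
      field_simp
      ring
  obtain ⟨A, hA⟩ := hsum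
  refine ⟨A, Real.ofDigits fun l => a (l + (i + 1)), Real.ofDigits_nonneg _,
    Real.ofDigits_le_one _, ?_⟩
  rw [Real.ofDigits_eq_sum_add_ofDigits a (i + 1), mul_add, hA]
  field_simp

theorem getElem?_flatten_zerosOne (m r i : ℕ) (h : i < r * (m + 1)) :
    (List.replicate r (zerosOne m)).flatten[i]? = some (decide (m + 1 ∣ i + 1)) := by
  induction r generalizing i with
  | zero => simp at h
  | succ r ih =>
    rw [List.replicate_succ, List.flatten_cons]
    by_cases hi : i < m + 1
    · rw [List.getElem?_append_left (by rwa [length_zerosOne]), zerosOne]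
      rcases Nat.lt_succ_iff_lt_or_eq.1 hi with hi' | rfl
      · have : ¬ m + 1 ∣ i + 1 := Nat.not_dvd_of_pos_of_lt (by omega) (by omega)
        simp [List.getElem?_append_left, hi', this]
      · simp
    · obtain ⟨l, rfl⟩ := Nat.exists_eq_add_of_le (not_lt.1 hi)
      rw [List.getElem?_append_right (by simp [length_zerosOne]), length_zerosOne,
        Nat.add_sub_cancel_left, ih l (by rw [Nat.succ_mul] at h; omega), add_assoc (m + 1)]
      simp

theorem Phase.scan_append (q : Phase) (u v : List Bool) :
    q.scan (u ++ v) = (q.scan u).scan v :=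
  List.foldl_append

theorem scan_firstPart {k : ℕ} (hk : 0 < k) :
    Phase.start.scan ((List.range (3 * k)).flatMap (fun i => zerosOne (2 ^ i)) ++ [true]) =
      .middle := by
  obtain ⟨j, hj⟩ : ∃ j, 3 * k = j + 1 := ⟨3 * k - 1, by omega⟩
  have h0 : (1 : ZMod 3) + j = 0 := by
    have : ((j + 1 : ℕ) : ZMod 3) = 0 := (ZMod.natCast_eq_zero_iff _ _).2 ⟨k, hj.symm⟩
    rw [← this]
    push_cast
    ring
  have h := zerosOne_append_doublingBlocks 1 j
  simp only [mul_one] at h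
  rw [hj, ← h, List.append_assoc]
  refine (Phase.scan_doublingBlocks 1 one_pos j [true]).trans ?_
  rw [h0]
  rfl

theorem bias_mul_pow (I : Set ℕ+) (k : ℕ+) :
    ∃ (A : ℕ) (r : ℝ), 0 ≤ r ∧ r ≤ 1 ∧
      (2 ^ (3 * (k : ℕ)) : ℕ) * (bias I : ℝ) =
        8 * A + (open Classical in if k ∈ I then 5 else 1) + r := by
  obtain ⟨A, r, h0, h1, h⟩ := exists_pow_mul_ofDigits (biasDigit I) (by norm_num) k.natPred
  refine ⟨A, r, h0, h1, ?_⟩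
  rw [PNat.natPred_add_one] at h
  rw [pow_mul]
  have hd : biasDigit I k.natPred = open Classical in if k ∈ I then 5 else 1 := by
    rw [biasDigit, PNat.succPNat_natPred]
  rw [hd] at h
  push_cast at h ⊢
  norm_num only [bias] at h ⊢
  rw [h]
  split_ifs <;> norm_num

open Classical in
/-- On a member of `DIMA2`, with a prover that sends the input, the test with the coin has the
right result with probability at least `3/4`. -/
theorem le_hitFrom_coin_dima2Word (I : Set ℕ+) (k : ℕ+) {P : (scanVerifier (bias I)).Prover}
    (hP : Follows (proverMessage P (dima2Word k)) 0 (dima2Word k)) :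
    ENNReal.ofReal (3 / 4) ≤ (scanVerifier (bias I)).hitFrom P (dima2Word k)
      (if k ∈ I then .accept else .reject) (scanConfig (bias I) (.read (.coin .start 0)) 1 0) := by
  set s : VerifierState ScanRead ScanQuery := if k ∈ I then .accept else .reject with hsdef
  have hs : s = .accept ∨ s = .reject := by
    rw [hsdef]
    split_ifs <;> simp
  set m := 2 ^ (3 * (k : ℕ)) with hm
  set w := dima2Word k with hwdef
  set u := (List.range (3 * (k : ℕ))).flatMap (fun i => zerosOne (2 ^ i)) ++ [true] with hu
  set v := (List.replicate m (zerosOne m)).flatten with hv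
  have hw : w = u ++ v := rfl
  have hvlen : v.length = m * (m + 1) := by
    simp [hv, length_zerosOne]
  have hscan := (ScanTest.dima2Word_scan_transcript k.pos).1
  have humid : Phase.start.scan u = .middle := by
    rw [hu]
    exact scan_firstPart k.pos
  have hvscan : Phase.middle.scan v = .tail true := by
    rwa [← hwdef, hw, Phase.scan_append, humid] at hscan
  obtain ⟨A, r, hr0, hr1, hA⟩ := bias_mul_pow I k
  rw [← hm] at hA
  have hy : ∀ i < m * (m + 1),
      proverMessage P w (u.length + i) = decide (m + 1 ∣ i + 1) := by
    intro i hi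
    have hfol := (follows_append.1 (hw ▸ hP)).2
    rw [zero_add] at hfol
    exact hfol.eq_of_getElem? (getElem?_flatten_zerosOne m m i hi)
  -- With `h` within `m + 1` of the mean, `h / (m + 1)` lies between `8A + d - 1` and `8A + d + 1`.
  -- Modulo 8 this is 4 to 6 for `d = 5` and 0 to 2 for `d = 1`, on opposite sides of the threshold
  -- 4.
  have hM : ∀ h : ℕ, |(h : ℝ) - (m + 1 : ℕ) * (m * bias I)| < (m + 1 : ℕ) →
      (if h / (m + 1) % 8 < 4 then .reject else .accept) = s := by
    intro h hh
    have hpos : (0 : ℝ) < (m + 1 : ℕ) := by positivity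
    rw [abs_lt, hA] at hh
    have hdigit : ∀ d : ℕ, 1 ≤ d →
        ((m + 1 : ℕ) : ℝ) * (8 * A + d + r) - (m + 1 : ℕ) < h →
        (h : ℝ) < (m + 1 : ℕ) * (8 * A + d + r) + (m + 1 : ℕ) →
        8 * A + d - 1 ≤ h / (m + 1) ∧ h / (m + 1) < 8 * A + d + 2 := by
      intro d hd h1 h2
      rw [Nat.le_div_iff_mul_le m.succ_pos, Nat.div_lt_iff_lt_mul m.succ_pos]
      have e1 : (((8 * A + d - 1) * (m + 1) : ℕ) : ℝ) ≤ h := by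
        rw [Nat.cast_mul, Nat.cast_sub (by omega)]
        push_cast at h1 ⊢
        nlinarith
      have e2 : (h : ℝ) < ((8 * A + d + 2) * (m + 1) : ℕ) := by
        push_cast at h2 ⊢
        nlinarith
      exact ⟨Nat.cast_le.1 e1, Nat.cast_lt.1 e2⟩
    by_cases hk : k ∈ I
    · simp only [hk, if_true] at hh hsdef
      have := hdigit 5 (by norm_num) (by push_cast at hh ⊢; linarith)
        (by push_cast at hh ⊢; linarith)
      rw [hsdef, if_neg (by omega)]
    · simp only [hk, if_false] at hh hsdef
      have := hdigit 1 (by norm_num) (by push_cast at hh ⊢; linarith)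
        (by push_cast at hh ⊢; linarith)
      rw [hsdef, if_pos (by omega)]
  have hfirst := hitFrom_coin_firstPart (p := bias I) (P := P) (w := w) hs .start [] u v hw 0 humid
  have hsecond := le_hitFrom_coin (p := bias I) (P := P) (w := w) hs m.succ_pos hy hM .middle rfl
    u v hw hvscan 0 (by rw [hvlen, zero_add]) 0 (by simp)
  simp only [List.nil_append, List.length_nil, zero_add] at hfirst
  refine le_trans (le_trans (ENNReal.ofReal_le_ofReal ?_) hsecond) hfirst
  rw [hvlen]
  set p : ℝ := (bias I : ℝ)
  have hp : p * (1 - p) ≤ 1 / 4 := by nlinarith [sq_nonneg (p - 1 / 2)]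
  have hmean : ((0 : ℕ) : ℝ) + (m * (m + 1) : ℕ) * p - (m + 1 : ℕ) * (m * p) = 0 := by
    push_cast
    ring
  rw [hmean]
  have hm0 : (0 : ℝ) ≤ m := by positivity
  -- The variance is at most `m(m+1)/4 ≤ (m+1)²/4`.
  have : (0 ^ 2 + ((m * (m + 1) : ℕ) : ℝ) * (p * (1 - p))) / ((m + 1 : ℕ) : ℝ) ^ 2 ≤ 1 / 4 := by
    rw [div_le_iff₀ (by positivity)]
    push_cast
    nlinarith [mul_le_mul_of_nonneg_left hp (by positivity : 0 ≤ (m : ℝ) * (m + 1))]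
  linarith

/-! ### Error bounds and uncountability -/

section

variable {p : unitInterval} {P : (scanVerifier p).Prover} {w : List Bool}
  {s : VerifierState ScanRead ScanQuery}

theorem ofReal_sum_le_haltProb (hs : s = .accept ∨ s = .reject) {g : Fin 7 → ℝ}
    (hg : ∀ i, 0 ≤ g i)
    (h : ∀ i, ENNReal.ofReal (g i) ≤
      (scanVerifier p).hitFrom P w s (scanConfig p (chooseTest i) 1 0)) :
    ENNReal.ofReal ((∑ i, g i) / 7) ≤ (scanVerifier p).haltProb P w s := by
  have hstep : (scanVerifier p).step P w (scanVerifier p).initConfig =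
      (PMF.uniformOfFintype (Fin 7)).map fun i => scanConfig p (chooseTest i) 1 0 :=
    PFAVerifier.step_read (V := scanVerifier p) (G := fun i => (chooseTest i, HeadMove.right)) rfl
  refine le_trans ?_ ((PFAVerifier.sum_hitFrom_le hs hstep).trans_eq
    PFAVerifier.haltProb_eq_hitFrom.symm)
  rw [div_eq_inv_mul, Finset.mul_sum, ENNReal.ofReal_sum_of_nonneg fun i _ => by
    have := hg i
    positivity]
  refine Finset.sum_le_sum fun i _ => ?_
  rw [ENNReal.ofReal_mul (by norm_num), PMF.uniformOfFintype_apply, Fintype.card_fin,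
    ENNReal.ofReal_inv_of_pos (by norm_num)]
  refine mul_le_mul' (by simp) (h i)

/-- The message of the prover passes the test `X`. -/
def Passes (P : (scanVerifier p).Prover) (w : List Bool) (X : ScanTest) : Prop :=
  Phase.start.scan w = .tail true ∧ Follows (proverMessage P w) 0 (X.transcript .start w)

theorem hitFrom_accept_of_passes {X : ScanTest} (h : Passes P w X) :
    1 ≤ (scanVerifier p).hitFrom P w .accept (scanConfig p (.read (.test X .start)) 1 0) := by
  have := one_le_hitFrom_test (p := p) (P := P) (w := w) X .start 0 [] w rfl
  have hr : testResult (proverMessage P w) X .start 0 w = .accept := if_pos h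
  rwa [hr] at this

theorem hitFrom_reject_of_not_passes {X : ScanTest} (h : ¬ Passes P w X) :
    1 ≤ (scanVerifier p).hitFrom P w .reject (scanConfig p (.read (.test X .start)) 1 0) := by
  have := one_le_hitFrom_test (p := p) (P := P) (w := w) X .start 0 [] w rfl
  have hr : testResult (proverMessage P w) X .start 0 w = .reject := if_neg h
  rwa [hr] at this

/-- Three of the seven initial outcomes reject outright, so a single test rejecting with probability
`3/4` gives `(3 + 3/4)/7 > 1/2`. -/
theorem le_rejectProb (i : Fin 7) (hi : i < 4)
    (h : ENNReal.ofReal (3 / 4) ≤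
      (scanVerifier p).hitFrom P w .reject (scanConfig p (chooseTest i) 1 0)) :
    ENNReal.ofReal (15 / 28) ≤ (scanVerifier p).rejectProb P w := by
  have hsum : (15 / 28 : ℝ) =
      (∑ l : Fin 7, if l = i then (3 / 4 : ℝ) else if l < 4 then 0 else 1) / 7 := by
    rw [Fin.sum_univ_seven]
    fin_cases i <;> first
      | exact absurd hi (by decide)
      | (simp +decide only [if_true, if_false]; norm_num)
  rw [hsum]
  refine ofReal_sum_le_haltProb (Or.inr rfl) (fun l => by split_ifs <;> norm_num) fun l => ?_
  split_ifs with h1 h2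
  · rwa [h1]
  · simp
  · have hl : chooseTest l = .reject := by
      fin_cases l <;> first | rfl | exact absurd (by decide) h2
    rw [hl, ENNReal.ofReal_one]
    exact PFAVerifier.hitFrom_of_state_eq rfl

theorem le_acceptProb (hX : ∀ X, Passes P w X)
    (h : ENNReal.ofReal (3 / 4) ≤
      (scanVerifier p).hitFrom P w .accept (scanConfig p (.read (.coin .start 0)) 1 0)) :
    ENNReal.ofReal (15 / 28) ≤ (scanVerifier p).acceptProb P w := by
  have hsum : (15 / 28 : ℝ) = (∑ l : Fin 7, ![1, 1, 1, 3 / 4, 0, 0, 0] l) / 7 := by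
    simp only [Fin.sum_univ_succ, Matrix.cons_val_zero, Matrix.cons_val_succ, Fin.sum_univ_zero]
    norm_num
  rw [hsum]
  refine ofReal_sum_le_haltProb (Or.inl rfl) (fun l => ?_) fun l => ?_
  · fin_cases l <;> norm_num
  · fin_cases l
    · exact ENNReal.ofReal_one.trans_le (hitFrom_accept_of_passes (hX .copy))
    · exact ENNReal.ofReal_one.trans_le (hitFrom_accept_of_passes (hX .double))
    · exact ENNReal.ofReal_one.trans_le (hitFrom_accept_of_passes (hX .count))
    · exact h
    all_goals exact ENNReal.ofReal_zero.trans_le zero_le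

end

theorem dima2Word_mem_DIMA2Sub {I : Set ℕ+} {k : ℕ+} : dima2Word k ∈ DIMA2Sub I ↔ k ∈ I := by
  constructor
  · rintro ⟨l, hl, h⟩
    have := dima2Word_length_strictMono.injective
      (congrArg List.length ((isKthShortest_DIMA2_iff l l.pos _).1 h))
    rwa [PNat.coe_injective this]
  · exact fun hk => ⟨k, hk, (isKthShortest_DIMA2_iff k k.pos _).2 rfl⟩

theorem scanVerifier_verifies (I : Set ℕ+) :
    (scanVerifier (bias I)).Verifies (DIMA2Sub I) (13 / 28) := by
  have hε : (1 - 13 / 28 : ℝ) = 15 / 28 := by norm_num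
  rw [PFAVerifier.Verifies, hε]
  -- The honest prover sends the input; `l` includes the current request, hence `l.length - 1`.
  refine ⟨⟨fun w l => w.getD (l.length - 1) false, ?_⟩, fun P w hw => ?_⟩
  · rintro w ⟨k, hk, hw⟩
    obtain rfl := (isKthShortest_DIMA2_iff k k.pos w).1 hw
    set P : (scanVerifier (bias I)).Prover :=
      fun w (l : List Bool) => w.getD (l.length - 1) false
    have hP : Follows (proverMessage P (dima2Word k)) 0 (dima2Word k) := by
      have hmsg : proverMessage P (dima2Word k) =
          fun n => ([] ++ dima2Word k).getD n false := by
        funext n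
        change (dima2Word k).getD ((List.replicate (n + 1) false).length - 1) false = _
        rw [List.length_replicate]
        rfl
      rw [hmsg]
      exact follows_of_getD 0 [] (dima2Word k) rfl
    obtain ⟨h1, h2⟩ := ScanTest.dima2Word_scan_transcript k.pos
    have hcoin := le_hitFrom_coin_dima2Word I k hP
    rw [if_pos hk] at hcoin
    exact le_acceptProb (fun X => ⟨h1, hP.of_prefix (h2 X)⟩) hcoin
  -- If all deterministic tests pass, `w` is a `dima2Word k` with `k ∉ I` and the message begins
  -- with `w`, so the coin rejects; otherwise the failed test does.
  · by_cases hX : ∀ X, Passes P w X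
    · have hcopy := (hX .copy).2
      rw [ScanTest.transcript_copy] at hcopy
      obtain ⟨z, hz⟩ := hcopy.exists_prefix (hX .double).2
      obtain ⟨z', hz'⟩ := hcopy.exists_prefix (hX .count).2
      obtain ⟨k, hk, rfl⟩ := ScanTest.mem_DIMA2_of_transcript_prefix (hX .copy).1 hz hz'
      lift k to ℕ+ using hk
      have hcoin := le_hitFrom_coin_dima2Word I k hcopy
      rw [if_neg fun h => hw (dima2Word_mem_DIMA2Sub.2 h)] at hcoin
      exact le_rejectProb 3 (by decide) hcoin
    · push Not at hX
      obtain ⟨X, hX⟩ := hX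
      have h1 := (ENNReal.ofReal_le_one.2 (by norm_num : (3 / 4 : ℝ) ≤ 1)).trans
        (hitFrom_reject_of_not_passes hX)
      rcases X with _ | _ | _
      · exact le_rejectProb 0 (by decide) h1
      · exact le_rejectProb 1 (by decide) h1
      · exact le_rejectProb 2 (by decide) h1

theorem theorem9 :
    (∀ I : Set ℕ+, LinearTimeSweepingVerifiable (DIMA2Sub I)) ∧
    ¬ {L : Language Bool | LinearTimeSweepingVerifiable L}.Countable := by
  have h : ∀ I : Set ℕ+, LinearTimeSweepingVerifiable (DIMA2Sub I) := fun I =>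
    ⟨scanVerifier (bias I), isSweeping_scanVerifier _, isLinearTime_scanVerifier _, 13 / 28,
      by norm_num, scanVerifier_verifies I⟩
  refine ⟨h, fun hcount => ?_⟩
  have hinj : Function.Injective DIMA2Sub := fun I J hIJ => by
    ext k
    rw [← dima2Word_mem_DIMA2Sub, hIJ, dima2Word_mem_DIMA2Sub]
  have huniv : (Set.univ : Set (Set ℕ+)).Countable :=
    (hcount.preimage_of_injOn hinj.injOn).mono fun I _ => h I
  have : Countable (Set ℕ+) := Set.countable_univ_iff.1 huniv
  obtain ⟨f, hf⟩ := exists_injective_nat (Set ℕ+)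
  exact Function.cantor_injective (fun I => (f I).succPNat) (Nat.succPNat_injective.comp hf)
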